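/- Let $X=\{0,1\}^{\mathbb N}$ be the Cantor space, where $\{0,1\}$ is discrete, with the compatible metric $d(\sigma,\sigma)=0$ and $d(\sigma,\tau)=1/n$ for $\sigma\ne\tau$, where $n$ is the least positive integer with $\sigma(n)\neq\tau(n)$. Let $\mathcal C(X)$ be the space of all continuous maps $f:X\to X$ with the metric $\tilde d(f,g)=\max_{x\in X}d(f(x),g(x))$, and let $\mathcal M(X)$ be the space of all Borel probability measures on $X$ with the Prohorov metric $$d_P(\mu,\nu)=\inf\{\delta>0:\ \mu(A)\le\nu(A^\delta)+\delta\ \text{ and }\ \nu(A)\le\mu(A^\delta)+\delta\ \text{ for all Borel } A\subset X\},$$ where $A^\delta=\{x\in X: d(x,A)<\delta\}$ (with $\emptyset^\delta=\emptyset$). Each $f\in\mathcal C(X)$ induces the map $\tilde f:\mathcal M(X)\to\mathcal M(X)$, $(\tilde f(\mu))(A)=\mu(f^{-1}(A))$ for $A \subset X$ Borel. Theorem. For the generic $f\in\mathcal C(X)$, that is, for all $f$ outside a set of the first category (a meagre set) in $\mathcal C(X)$, the map $\tilde f$ is equicontinuous at every point of $\mathcal M(X)$: for every $\mu\in\mathcal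 M(X)$ and every $\varepsilon>0$ there is $\delta>0$ such that for all $\nu\in\mathcal M(X)$, $$d_P(\nu,\mu)<\delta\ \Longrightarrow\ d_P(\tilde f^{\,n}(\nu),\tilde f^{\,n}(\mu))<\varepsilon\quad\text{for all } n\ge 0.$$ -/

import Mathlib

open MeasureTheory

/-- The Cantor space `{0,1}^ℕ`.  This is a type synonym, so that it can carry the metric `1 / n`
below (coordinates are numbered from `0` here, hence `1 / (k + 1)`). -/
def CantorSpace : Type := ℕ → Bool

namespace CantorSpace

/-- The product topology of the discrete topologies. -/
instance : TopologicalSpace CantorSpace := inferInstanceAs (TopologicalSpace (ℕ → Bool))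

instance : CompactSpace CantorSpace := inferInstanceAs (CompactSpace (ℕ → Bool))

open Classical in
/-- `d(σ, σ) = 0`, and `d(σ, τ) = 1 / n` when the first difference of `σ ≠ τ` is in the
`n`-th coordinate, counting from `n = 1`. -/
noncomputable def cantorDist (σ τ : CantorSpace) : ℝ :=
  if h : ∃ k : ℕ, σ k ≠ τ k then 1 / ((Nat.find h : ℝ) + 1) else 0

theorem cantorDist_self (σ : CantorSpace) : cantorDist σ σ = 0 := by
  simp [cantorDist]

theorem cantorDist_comm (σ τ : CantorSpace) : cantorDist σ τ = cantorDist τ σ := by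
  have h : (fun k => σ k ≠ τ k) = fun k => τ k ≠ σ k := funext fun k => propext ne_comm
  unfold cantorDist
  congr! 5

theorem cantorDist_nonneg (σ τ : CantorSpace) : 0 ≤ cantorDist σ τ := by
  unfold cantorDist
  split_ifs <;> positivity

/-- `d(σ, τ) < 1 / (n + 1)` exactly when `σ` and `τ` agree in the coordinates `0, …, n`. -/
theorem cantorDist_lt_iff (σ τ : CantorSpace) (n : ℕ) :
    cantorDist σ τ < 1 / ((n : ℝ) + 1) ↔ ∀ k ≤ n, σ k = τ k := by
  classical
  unfold cantorDist
  split_ifs with h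
  · rw [one_div_lt_one_div (by positivity) (by positivity), add_lt_add_iff_right, Nat.cast_lt,
      Nat.lt_find_iff]
    simp
  · push Not at h
    exact ⟨fun _ k _ => h k, fun _ => by positivity⟩

theorem eq_of_cantorDist_eq_zero (σ τ : CantorSpace) (h : cantorDist σ τ = 0) : σ = τ := by
  funext n
  exact (cantorDist_lt_iff σ τ n).1 (by rw [h]; positivity) n le_rfl

theorem cantorDist_triangle (ρ σ τ : CantorSpace) :
    cantorDist ρ τ ≤ cantorDist ρ σ + cantorDist σ τ := by
  classical
  by_cases h : ∃ k : ℕ, ρ k ≠ τ k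
  · have hval : cantorDist ρ τ = 1 / ((Nat.find h : ℝ) + 1) := by
      unfold cantorDist
      rw [dif_pos h]
    have h1 := cantorDist_nonneg ρ σ
    have h2 := cantorDist_nonneg σ τ
    by_contra! hlt
    rw [hval] at hlt
    have e1 := (cantorDist_lt_iff ρ σ (Nat.find h)).1 (by linarith) _ le_rfl
    have e2 := (cantorDist_lt_iff σ τ (Nat.find h)).1 (by linarith) _ le_rfl
    exact Nat.find_spec h (e1.trans e2)
  · have hval : cantorDist ρ τ = 0 := by
      unfold cantorDist
      rw [dif_neg h]
    rw [hval]
    exact add_nonneg (cantorDist_nonneg ρ σ) (cantorDist_nonneg σ τ)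

theorem isOpen_iff_cantorDist (s : Set CantorSpace) :
    IsOpen s ↔ ∀ σ ∈ s, ∃ ε > 0, ∀ τ, cantorDist σ τ < ε → τ ∈ s := by
  refine (PiNat.isOpen_iff_dist (E := fun _ : ℕ => Bool) s).trans ?_
  refine forall₂_congr fun σ _ => ?_
  constructor
  · rintro ⟨ε, hε, H⟩
    obtain ⟨n, hn⟩ : ∃ n : ℕ, (1 / 2 : ℝ) ^ n < ε := exists_pow_lt_of_lt_one hε one_half_lt_one
    refine ⟨1 / ((n : ℝ) + 1), by positivity, fun τ hτ => H τ ?_⟩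
    have hk := (cantorDist_lt_iff σ τ n).1 hτ
    exact lt_of_le_of_lt
      (PiNat.mem_cylinder_iff_dist_le.1 (PiNat.mem_cylinder_iff.2 fun i hi => hk i hi.le)) hn
  · rintro ⟨ε, hε, H⟩
    obtain ⟨n, hn⟩ := exists_nat_one_div_lt hε
    refine ⟨(1 / 2 : ℝ) ^ n, by positivity, fun τ hτ => H τ (lt_trans ?_ hn)⟩
    exact (cantorDist_lt_iff σ τ n).2 fun k hk => PiNat.apply_eq_of_dist_lt hτ hk

/-- The metric `cantorDist`, whose topology is (definitionally) the product topology. -/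
noncomputable instance : MetricSpace CantorSpace :=
  MetricSpace.ofDistTopology cantorDist cantorDist_self cantorDist_comm cantorDist_triangle
    isOpen_iff_cantorDist eq_of_cantorDist_eq_zero

/-- The Borel σ-algebra. -/
instance : MeasurableSpace CantorSpace := borel CantorSpace

instance : BorelSpace CantorSpace := ⟨rfl⟩

end CantorSpace

/-- The space `𝓜(M)` of all Borel probability measures on `M`, with the Prohorov metric. -/
abbrev ProhorovSpace (M : Type*) [MeasurableSpace M] : Type _ :=
  LevyProkhorov (ProbabilityMeasure M)

/-- The map `𝓜(M) → 𝓜(M)` induced by a continuous map `f : M → M`: it sends `μ` to its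
push-forward `X ↦ μ (f⁻¹(X))`. -/
noncomputable def inducedMap {M : Type*} [TopologicalSpace M] [MeasurableSpace M] [BorelSpace M]
    (f : C(M, M)) (μ : ProhorovSpace M) : ProhorovSpace M :=
  LevyProkhorov.ofMeasure (μ.toMeasure.map f.continuous.measurable.aemeasurable)

/-- A self-map `f` of a metric space is equicontinuous at `x` if for every `ε > 0` there is
`δ > 0` such that `d(y, x) < δ` implies `d(fⁿ(y), fⁿ(x)) < ε` for all `n ≥ 0`. -/
def IsEquicontinuousMapAt {M : Type*} [MetricSpace M] (f : M → M) (x : M) : Prop :=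
  ∀ ε > 0, ∃ δ > 0, ∀ y, dist y x < δ → ∀ n : ℕ, dist (f^[n] y) (f^[n] x) < ε

/-! If `f` maps each cylinder of level `n` into a cylinder of level `n`, so do all its iterates.
When this happens for arbitrarily large `n`, the iterates are uniformly equicontinuous. Having such
`n` above every bound is a countable intersection of open dense conditions, hence generic.
Equicontinuity passes to measures because a small thickening of the preimage of `B` under an iterate
lies in the preimage of a thickening of `B`, uniformly in the iterate. -/

open Metric in
/-- If the iterates of `f` are uniformly equicontinuous, then the induced map on probability
measures is equicontinuous at every point for the Prohorov metric. -/
theorem isEquicontinuousMapAt_inducedMap {M : Type*} [MetricSpace M] [MeasurableSpace M]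
    [BorelSpace M] {f : C(M, M)}
    (hf : ∀ ε > 0, ∃ δ > 0, ∀ x y, dist x y < δ → ∀ n : ℕ, dist (f^[n] x) (f^[n] y) < ε)
    (μ : ProhorovSpace M) : IsEquicontinuousMapAt (inducedMap f) μ := by
  have hmeas : ∀ n : ℕ, Measurable f^[n] := fun n => (f.continuous.iterate n).measurable
  have hiter : ∀ (n : ℕ) (ρ : ProhorovSpace M),
      (((inducedMap f)^[n] ρ).toMeasure : Measure M) = (ρ.toMeasure : Measure M).map f^[n] := by
    intro n ρ
    induction n with
    | zero => simp
    | succ n ih =>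
      rw [Function.iterate_succ_apply', Function.iterate_succ',
        ← Measure.map_map f.continuous.measurable (hmeas n), ← ih]
      rfl
  intro ε hε
  obtain ⟨δ, hδ, H⟩ := hf (ε / 2) (half_pos hε)
  -- `δ` controls the thickening, `ε / 2` the additive error.
  refine ⟨min δ (ε / 2), lt_min hδ (half_pos hε), fun ν hν n => ?_⟩
  set η := min δ (ε / 2) with hη
  have hη0 : 0 < η := lt_min hδ (half_pos hε)
  have hlt : levyProkhorovEDist (ν.toMeasure : Measure M) (μ.toMeasure : Measure M)
      < ENNReal.ofReal η := by
    rw [LevyProkhorov.dist_probabilityMeasure_def, levyProkhorovDist] at hν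
    exact (ENNReal.lt_ofReal_iff_toReal_lt (levyProkhorovEDist_ne_top _ _)).2 hν
  refine lt_of_le_of_lt ?_ (half_lt_self hε)
  rw [LevyProkhorov.dist_probabilityMeasure_def]
  -- For probability measures one of the two Prohorov inequalities suffices; complements give the
  -- other.
  refine levyProkhorovDist_le_of_forall_le _ _ (half_pos hε).le fun r B hr hB => ?_
  have hsub : thickening η (f^[n] ⁻¹' B) ⊆ f^[n] ⁻¹' thickening r B := by
    intro x hx
    obtain ⟨y, hy, hxy⟩ := mem_thickening_iff.1 hx
    exact mem_thickening_iff.2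
      ⟨f^[n] y, hy, (H x y (hxy.trans_le (min_le_left _ _)) n).trans hr⟩
  rw [hiter, hiter, Measure.map_apply (hmeas n) hB,
    Measure.map_apply (hmeas n) isOpen_thickening.measurableSet]
  refine (left_measure_le_of_levyProkhorovEDist_lt hlt (hmeas n hB)).trans ?_
  rw [ENNReal.toReal_ofReal hη0.le]
  exact add_le_add (measure_mono hsub)
    (ENNReal.ofReal_le_ofReal ((min_le_right _ _).trans hr.le))

namespace CantorSpace

theorem dist_lt_iff (σ τ : CantorSpace) (n : ℕ) :
    dist σ τ < 1 / ((n : ℝ) + 1) ↔ ∀ k ≤ n, σ k = τ k :=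
  cantorDist_lt_iff σ τ n

/-- Replace all coordinates after the `n`-th one by `false`. -/
def truncate (n : ℕ) (σ : CantorSpace) : CantorSpace := fun k => if k ≤ n then σ k else false

theorem dist_truncate_lt (n : ℕ) (σ : CantorSpace) : dist (truncate n σ) σ < 1 / ((n : ℝ) + 1) :=
  (dist_lt_iff _ _ n).2 fun _ hk => if_pos hk

theorem truncate_eq_of_dist_lt {n : ℕ} {σ τ : CantorSpace} (h : dist σ τ < 1 / ((n : ℝ) + 1)) :
    truncate n σ = truncate n τ := by
  funext k
  by_cases hk : k ≤ n
  · simp only [truncate, if_pos hk, (dist_lt_iff _ _ n).1 h k hk]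
  · simp only [truncate, if_neg hk]

theorem continuous_truncate (n : ℕ) : Continuous (truncate n) := by
  refine Metric.continuous_iff.2 fun τ ε hε => ⟨1 / ((n : ℝ) + 1), by positivity, fun σ h => ?_⟩
  rwa [truncate_eq_of_dist_lt h, dist_self]

/-- The maps that send every cylinder given by the coordinates `0, …, n` into another such
cylinder. -/
def cylinderPreserving (n : ℕ) : Set C(CantorSpace, CantorSpace) :=
  {f | ∀ σ τ, dist σ τ < 1 / ((n : ℝ) + 1) → dist (f σ) (f τ) < 1 / ((n : ℝ) + 1)}

theorem dist_iterate_lt_of_mem_cylinderPreserving {n : ℕ} {f : C(CantorSpace, CantorSpace)}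
    (hf : f ∈ cylinderPreserving n) {σ τ : CantorSpace} (h : dist σ τ < 1 / ((n : ℝ) + 1))
    (m : ℕ) : dist (f^[m] σ) (f^[m] τ) < 1 / ((n : ℝ) + 1) := by
  induction m with
  | zero => exact h
  | succ m ih =>
    rw [Function.iterate_succ_apply', Function.iterate_succ_apply']
    exact hf _ _ ih

/-- Membership depends only on the coordinates `0, …, n` of the values, and these are unchanged by
perturbations smaller than `1 / (n + 1)`. -/
theorem isOpen_cylinderPreserving (n : ℕ) : IsOpen (cylinderPreserving n) := by
  refine Metric.isOpen_iff.2 fun f hf => ⟨1 / ((n : ℝ) + 1), by positivity, fun g hg σ τ h => ?_⟩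
  have hgf : ∀ ρ, ∀ k ≤ n, g ρ k = f ρ k := fun ρ =>
    (dist_lt_iff _ _ n).1 ((ContinuousMap.dist_apply_le_dist ρ).trans_lt hg)
  refine (dist_lt_iff _ _ n).2 fun k hk => ?_
  rw [hgf σ k hk, hgf τ k hk, (dist_lt_iff _ _ n).1 (hf σ τ h) k hk]

/-- Precomposing `f` with `truncate n` makes it constant on cylinders of level `n` and, by uniform
continuity, moves it little once `n` is large. The union is needed since `n` depends on `f` and `ε`.
-/
theorem dense_iUnion_cylinderPreserving (m : ℕ) :
    Dense (⋃ n ≥ m, cylinderPreserving n) := by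
  intro f
  refine Metric.mem_closure_iff.2 fun ε hε => ?_
  obtain ⟨δ, hδ, H⟩ := f.uniform_continuity ε hε
  obtain ⟨N, hN⟩ := exists_nat_one_div_lt hδ
  set n := max m N
  have hn : 1 / ((n : ℝ) + 1) < δ :=
    (Nat.one_div_le_one_div (le_max_right m N)).trans_lt hN
  refine ⟨f.comp ⟨truncate n, continuous_truncate n⟩,
    Set.mem_biUnion (le_max_left m N) fun σ τ h => ?_, ?_⟩
  · change dist (f (truncate n σ)) (f (truncate n τ)) < _
    rw [truncate_eq_of_dist_lt h, dist_self]
    positivity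
  · refine (ContinuousMap.dist_lt_iff hε).2 fun σ => ?_
    rw [dist_comm]
    exact H ((dist_truncate_lt n σ).trans hn)

end CantorSpace

/-- For the generic continuous self-map `f` of the Cantor space, i.e. for all `f` outside a set of
the first category in `C(CantorSpace, CantorSpace)` with the uniform metric, the induced map on
Borel probability measures is equicontinuous at every point. -/
theorem theorem3p4 :
    IsMeagre {f : C(CantorSpace, CantorSpace) |
      ¬ ∀ μ : ProhorovSpace CantorSpace, IsEquicontinuousMapAt (inducedMap f) μ} := by
  have hres : (⋂ m : ℕ, ⋃ n ≥ m, CantorSpace.cylinderPreserving n) ∈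
      residual C(CantorSpace, CantorSpace) :=
    countable_iInter_mem.2 fun m => residual_of_dense_open
      (isOpen_biUnion fun n _ => CantorSpace.isOpen_cylinderPreserving n)
      (CantorSpace.dense_iUnion_cylinderPreserving m)
  refine Filter.mem_of_superset hres fun f hf => not_not.2 ?_
  refine isEquicontinuousMapAt_inducedMap fun ε hε => ?_
  obtain ⟨m, hm⟩ := exists_nat_one_div_lt hε
  obtain ⟨n, hmn, hn⟩ := Set.mem_iUnion₂.1 (Set.mem_iInter.1 hf m)
  exact ⟨1 / ((n : ℝ) + 1), by positivity, fun σ τ h k =>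
    (CantorSpace.dist_iterate_lt_of_mem_cylinderPreserving hn h k).trans_le
      ((Nat.one_div_le_one_div hmn).trans hm.le)⟩
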